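/- Let $L=\{+,0\}$ be the vocabulary of groups. For infinite cardinals $\lambda\le\kappa$ let $L_{\kappa\lambda}$ be the infinitary language built from the atomic $L$-formulas by negation, conjunctions and disjunctions of fewer than $\kappa$ formulas, and existential and universal quantifier strings of length less than $\lambda$; let $L_{\infty\lambda}$ be the union of the $L_{\kappa\lambda}$ over all infinite cardinals $\kappa\ge\lambda$. Two groups are $L_{\kappa\lambda}$-equivalent (respectively $L_{\infty\lambda}$-equivalent) if they satisfy the same sentences of $L_{\kappa\lambda}$ (respectively $L_{\infty\lambda}$). An abelian group $G$ is slender if it is torsion-free and, for every homomorphism $h:\mathbb{Z}^\omega\to G$, $h(e_n)=0$ for all but finitely many $n$, where $e_n$ is the $n$-th standard unit vector. Corollary 0.2. The Baer–Specker group $\mathbb{Z}^\omega$ (the product of countably many copies of $\mathbb{Z}$) is not $L_{\infty\omega_1}$-equivalent to any slender abelian group. In fact, it is not even $L_{(2^{\aleph_0})^+\aleph_1}$-equivalent to any slender abelian group. -/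

import Mathlib

open Cardinal

universe u v w u₁ u₂

/-- Function symbols of the vocabulary of groups: a constant `0` and a binary symbol `+`. -/
inductive GroupFunctions : ℕ → Type
  | zero : GroupFunctions 0
  | add : GroupFunctions 2

/-- The vocabulary of (abelian) groups `{+, 0}`, with no relation symbols besides equality. -/
def groupLanguage : FirstOrder.Language.{0, 0} :=
  ⟨GroupFunctions, fun _ => Empty⟩

/-- Every additive abelian group is a structure for the vocabulary of groups. -/
instance groupStructure (G : Type u) [AddCommGroup G] : groupLanguage.Structure G where
  funMap := fun {_} f => match f with
    | .zero => fun _ => 0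
    | .add => fun x => x 0 + x 1
  RelMap := fun {_} r => Empty.elim r

/-- Infinitary formulas over the vocabulary `L` with free variables in `α`. Conjunctions and
disjunctions are over arbitrary index sets; a quantifier binds a string of variables indexed by
an arbitrary set `β`, so that its body has free variables in `α ⊕ β`. -/
inductive InfFormula (L : FirstOrder.Language.{u, v}) : Type w → Type (max u v (w + 1))
  | equal {α : Type w} (t₁ t₂ : L.Term α) : InfFormula L α
  | rel {α : Type w} {n : ℕ} (R : L.Relations n) (ts : Fin n → L.Term α) : InfFormula L α
  | not {α : Type w} (φ : InfFormula L α) : InfFormula L α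
  | conj {α : Type w} (ι : Type w) (φ : ι → InfFormula L α) : InfFormula L α
  | disj {α : Type w} (ι : Type w) (φ : ι → InfFormula L α) : InfFormula L α
  | ex {α : Type w} (β : Type w) (φ : InfFormula L (α ⊕ β)) : InfFormula L α
  | all {α : Type w} (β : Type w) (φ : InfFormula L (α ⊕ β)) : InfFormula L α

namespace InfFormula

/-- Satisfaction of an infinitary formula in a structure `M` under an assignment `s`. -/
def Realize {L : FirstOrder.Language.{u, v}} (M : Type u₁) [L.Structure M] :
    {α : Type w} → InfFormula L α → (α → M) → Prop
  | _, equal t₁ t₂, s => t₁.realize s = t₂.realize s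
  | _, rel R ts, s => FirstOrder.Language.Structure.RelMap R (fun i => (ts i).realize s)
  | _, not φ, s => ¬ Realize M φ s
  | _, conj _ φ, s => ∀ i, Realize M (φ i) s
  | _, disj _ φ, s => ∃ i, Realize M (φ i) s
  | _, ex β φ, s => ∃ b : β → M, Realize M φ (Sum.elim s b)
  | _, all β φ, s => ∀ b : β → M, Realize M φ (Sum.elim s b)

/-- `φ.InLogic κ l` says that `φ` is a formula of `L_{κ l}`: all conjunctions and disjunctions in
it have fewer than `κ` members, and all quantifier strings have length less than `l`. -/
def InLogic {L : FirstOrder.Language.{u, v}} (κ l : Cardinal.{w}) :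
    {α : Type w} → InfFormula L α → Prop
  | _, equal _ _ => True
  | _, rel _ _ => True
  | _, not φ => InLogic κ l φ
  | _, conj ι φ => #ι < κ ∧ ∀ i, InLogic κ l (φ i)
  | _, disj ι φ => #ι < κ ∧ ∀ i, InLogic κ l (φ i)
  | _, ex β φ => #β < l ∧ InLogic κ l φ
  | _, all β φ => #β < l ∧ InLogic κ l φ

/-- `φ` is a formula of `L_{∞ l}`, the union of the `L_{κ l}` over all infinite cardinals
`κ ≥ l`. -/
def InLogicInfty {L : FirstOrder.Language.{u, v}} (l : Cardinal.{w}) {α : Type w}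
    (φ : InfFormula L α) : Prop :=
  ∃ κ : Cardinal.{w}, ℵ₀ ≤ κ ∧ l ≤ κ ∧ φ.InLogic κ l

end InfFormula

/-- Infinitary sentences: formulas without free variables. -/
abbrev InfSentence (L : FirstOrder.Language.{u, v}) : Type (max u v (w + 1)) :=
  InfFormula.{u, v, w} L PEmpty.{w + 1}

/-- The sentence `φ` holds in `M`. -/
def InfSentence.Holds {L : FirstOrder.Language.{u, v}} (φ : InfSentence.{u, v, w} L)
    (M : Type u₁) [L.Structure M] : Prop :=
  InfFormula.Realize M φ PEmpty.elim

/-- `A ≡_{κ l} B`: the structures `A` and `B` satisfy the same sentences of `L_{κ l}`. -/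
def InfEquiv (L : FirstOrder.Language.{u, v}) (κ l : Cardinal.{w}) (A : Type u₁) (B : Type u₂)
    [L.Structure A] [L.Structure B] : Prop :=
  ∀ φ : InfSentence.{u, v, w} L, φ.InLogic κ l → (φ.Holds A ↔ φ.Holds B)

/-- `A ≡_{∞ l} B`: the structures `A` and `B` satisfy the same sentences of `L_{∞ l}`. -/
def InfEquivInfty (L : FirstOrder.Language.{u, v}) (l : Cardinal.{w}) (A : Type u₁) (B : Type u₂)
    [L.Structure A] [L.Structure B] : Prop :=
  ∀ φ : InfSentence.{u, v, w} L, φ.InLogicInfty l → (φ.Holds A ↔ φ.Holds B)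

/-- The Baer–Specker group `ℤ^ω`. -/
abbrev BaerSpecker : Type := ℕ → ℤ

/-- An abelian group `G` is slender if it is torsion-free and every homomorphism from `ℤ^ω` to `G`
sends all but finitely many of the standard unit vectors to `0`. -/
structure IsSlender (G : Type u) [AddCommGroup G] : Prop where
  torsionFree : IsAddTorsionFree G
  finite_support : ∀ h : BaerSpecker →+ G, {n : ℕ | h (Pi.single n 1) ≠ 0}.Finite

/-!
For infinitely many nonzero elements `y n` of distinct factors of a product of groups, every series
`∑ n! • a n • y n` converges coordinatewise. In an arbitrary group, `∑ n! • b n` has a sum when the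
recursion `r n = b n + (n + 1) • r (n + 1)` for its rescaled tails has a solution, and `r 0` is
then a sum. Hence a single sentence, with countable quantifier strings and one conjunct for each of
the `2 ^ ℵ₀` coefficient sequences, says that all these series have a sum for some sequence of
nonzero `y n`. It fails in a slender group: there sums are unique, because a slender group has no
divisible part, so `a ↦ ∑ n! • a n • y n` is a homomorphism from `ℤ^ω`, and it maps `e n` to
`n! • y n ≠ 0`.
-/

open FirstOrder.Language

section FactorialSum

variable {G : Type u} [AddCommGroup G]

/-- `g` is a sum of the formal series `∑ n! • b n`. Convergence is replaced by the existence of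
all rescaled tails `r n = ∑ m ≥ n, (m! / n!) • b m`; sums need not be unique. -/
def IsFactorialSum (b : ℕ → G) (g : G) : Prop :=
  ∃ r : ℕ → G, r 0 = g ∧ ∀ n, r n = b n + (n + 1) • r (n + 1)

namespace IsFactorialSum

theorem zero : IsFactorialSum (0 : ℕ → G) 0 :=
  ⟨0, rfl, fun n => by simp⟩

theorem add {b b' : ℕ → G} {g g' : G} (h : IsFactorialSum b g) (h' : IsFactorialSum b' g') :
    IsFactorialSum (b + b') (g + g') := by
  obtain ⟨r, rfl, hr⟩ := h
  obtain ⟨r', rfl, hr'⟩ := h'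
  refine ⟨r + r', rfl, fun n => ?_⟩
  simp only [Pi.add_apply, smul_add]
  rw [hr n, hr' n, add_add_add_comm]

theorem neg {b : ℕ → G} {g : G} (h : IsFactorialSum b g) : IsFactorialSum (-b) (-g) := by
  obtain ⟨r, rfl, hr⟩ := h
  refine ⟨-r, rfl, fun n => ?_⟩
  simp only [Pi.neg_apply, smul_neg]
  rw [hr n, neg_add]

theorem sub {b b' : ℕ → G} {g g' : G} (h : IsFactorialSum b g) (h' : IsFactorialSum b' g') :
    IsFactorialSum (b - b') (g - g') := by
  simpa only [sub_eq_add_neg] using h.add h'.neg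

theorem single (m : ℕ) (g : G) : IsFactorialSum (Pi.single m g) (m.factorial • g) := by
  refine ⟨fun n => if n ≤ m then m.descFactorial (m - n) • g else 0, ?_, fun n => ?_⟩
  · simp [Nat.descFactorial_self]
  · rcases lt_trichotomy n m with hnm | rfl | hmn
    · have hdesc : m.descFactorial (m - n) = (n + 1) * m.descFactorial (m - (n + 1)) := by
        rw [show m - n = m - (n + 1) + 1 by omega, Nat.descFactorial_succ,
          Nat.sub_sub_self hnm]
      simp [hnm.le, Nat.succ_le_of_lt hnm, hnm.ne, hdesc, mul_smul]
    · simp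
    · simp [hmn.not_ge, hmn.ne', (hmn.trans n.lt_succ_self).not_ge]

theorem pi {ι : Type*} {H : ι → Type*} [∀ i, AddCommGroup (H i)] {b : ℕ → ∀ i, H i}
    {g : ∀ i, H i} (h : ∀ i, IsFactorialSum (fun n => b n i) (g i)) : IsFactorialSum b g := by
  choose r hr₀ hr using h
  exact ⟨fun n i => r i n, funext hr₀, fun n => funext fun i => hr i n⟩

end IsFactorialSum

theorem exists_isFactorialSum_zsmul {y : ℕ → G}
    (hy : ∀ a : ℕ → ℕ, ∃ g, IsFactorialSum (fun n => a n • y n) g) (a : ℕ → ℤ) :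
    ∃ g, IsFactorialSum (fun n => a n • y n) g := by
  obtain ⟨g, hg⟩ := hy fun n => (a n).toNat
  obtain ⟨g', hg'⟩ := hy fun n => (-a n).toNat
  refine ⟨g - g', ?_⟩
  convert hg.sub hg' using 2 with n
  rw [Pi.sub_apply, ← natCast_zsmul, ← natCast_zsmul, ← sub_smul, Int.toNat_sub_toNat_neg]

theorem exists_isFactorialSum_pi_single {ι : Type*} [DecidableEq ι] {H : ι → Type*}
    [∀ i, AddCommGroup (H i)] (e : ℕ ↪ ι) (b : ∀ n, H (e n)) :
    ∃ g : ∀ i, H i, IsFactorialSum (fun n => Pi.single (e n) (b n)) g := by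
  suffices hcoord : ∀ i, ∃ g : H i,
      IsFactorialSum (fun n => (Pi.single (e n) (b n) : ∀ i, H i) i) g by
    choose g hg using hcoord
    exact ⟨g, .pi hg⟩
  intro i
  by_cases hi : i ∈ Set.range e
  · obtain ⟨m, rfl⟩ := hi
    refine ⟨m.factorial • b m, ?_⟩
    convert IsFactorialSum.single m (b m) using 1
    funext n
    rcases eq_or_ne n m with rfl | hnm
    · simp
    · simp [hnm]
  · refine ⟨0, ?_⟩
    convert IsFactorialSum.zero using 1
    funext n
    exact Pi.single_eq_of_ne (fun hn => hi ⟨n, hn.symm⟩) _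

end FactorialSum

section DivisiblePart

variable {G : Type u} [AddCommGroup G]

variable (G) in
/-- The largest divisible subgroup of `G`, encoded as the set of all `r 0` for sequences with
`r n = (n + 1) • r (n + 1)`, that is, as the set of sums of the zero series. -/
def divisiblePart : AddSubgroup G where
  carrier := {g | IsFactorialSum 0 g}
  zero_mem' := .zero
  add_mem' hg hg' := by simpa using hg.add hg'
  neg_mem' hg := by simpa using hg.neg

theorem mem_divisiblePart {g : G} : g ∈ divisiblePart G ↔ IsFactorialSum 0 g := .rfl

theorem IsFactorialSum.eq_of_divisiblePart_eq_bot (hG : divisiblePart G = ⊥) {b : ℕ → G}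
    {g g' : G} (h : IsFactorialSum b g) (h' : IsFactorialSum b g') : g = g' := by
  have hmem : g - g' ∈ divisiblePart G := mem_divisiblePart.2 (by simpa using h.sub h')
  rwa [hG, AddSubgroup.mem_bot, sub_eq_zero] at hmem

theorem exists_addMonoidHom_isFactorialSum (hG : divisiblePart G = ⊥) {y : ℕ → G}
    (hy : ∀ a : ℕ → ℤ, ∃ g, IsFactorialSum (fun n => a n • y n) g) :
    ∃ f : BaerSpecker →+ G, ∀ a, IsFactorialSum (fun n => a n • y n) (f a) := by
  choose f hf using hy
  refine ⟨.mk' f fun a b => (hf _).eq_of_divisiblePart_eq_bot hG ?_, hf⟩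
  convert (hf a).add (hf b) using 2 with n
  exact add_smul (a n) (b n) (y n)

section SuccSMul

variable {r : ℕ → G} (hr : ∀ n, r n = (n + 1) • r (n + 1))
include hr

theorem eq_factorial_smul_of_eq_succ_smul (n : ℕ) : r 0 = n.factorial • r n := by
  induction n with
  | zero => simp
  | succ n ih => rw [ih, hr n, ← mul_smul, Nat.factorial_succ, mul_comm]

theorem mem_divisiblePart_of_eq_succ_smul (n : ℕ) : r n ∈ divisiblePart G := by
  refine ⟨fun k => (n + k).choose k • r (n + k), by simp, fun k => ?_⟩
  have hchoose : (n + k).choose k * (n + k + 1) = (k + 1) * (n + k + 1).choose (k + 1) := by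
    rw [mul_comm, Nat.add_one_mul_choose_eq, mul_comm]
  simp only [Pi.zero_apply, zero_add]
  rw [hr (n + k), ← mul_smul, ← mul_smul, hchoose, add_assoc]

end SuccSMul

theorem exists_nsmul_eq_of_mem_divisiblePart {g : G} (hg : g ∈ divisiblePart G) {n : ℕ}
    (hn : n ≠ 0) : ∃ g' ∈ divisiblePart G, n • g' = g := by
  obtain ⟨r, rfl, hr⟩ := hg
  have hr' : ∀ k, r k = (k + 1) • r (k + 1) := by simpa using hr
  refine ⟨(n - 1).factorial • r n, nsmul_mem (mem_divisiblePart_of_eq_succ_smul hr' n) _, ?_⟩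
  rw [← mul_smul, Nat.mul_factorial_pred hn, ← eq_factorial_smul_of_eq_succ_smul hr']

noncomputable instance : DivisibleBy (divisiblePart G) ℤ :=
  have : DivisibleBy (divisiblePart G) ℕ := divisibleByOfSMulRightSurj _ _ fun hn g =>
    let ⟨g', hg', hgg'⟩ := exists_nsmul_eq_of_mem_divisiblePart g.2 hn
    ⟨⟨g', hg'⟩, Subtype.ext hgg'⟩
  AddGroup.divisibleByIntOfDivisibleByNat _

theorem exists_addMonoidHom_pi_single {ι : Type*} [DecidableEq ι] {D : Type*} [AddCommGroup D]
    [DivisibleBy D ℤ] (d : ι → D) : ∃ f : (ι → ℤ) →+ D, ∀ i, f (Pi.single i 1) = d i := by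
  obtain ⟨f, hf⟩ := (Module.Baer.of_divisible D).extension_property
    (Finsupp.lcoeFun : (ι →₀ ℤ) →ₗ[ℤ] ι → ℤ) DFunLike.coe_injective
    (Finsupp.linearCombination ℤ d)
  refine ⟨f.toAddMonoidHom, fun i => ?_⟩
  simpa [Finsupp.lcoeFun, Finsupp.single_eq_pi_single] using
    LinearMap.congr_fun hf (Finsupp.single i 1)

end DivisiblePart

namespace IsSlender

variable {G : Type u} [AddCommGroup G]

theorem divisiblePart_eq_bot (hG : IsSlender G) : divisiblePart G = ⊥ := by
  refine (AddSubgroup.eq_bot_iff_forall _).2 fun g hg => by_contra fun hne => ?_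
  obtain ⟨f, hf⟩ := exists_addMonoidHom_pi_single fun _ : ℕ => (⟨g, hg⟩ : divisiblePart G)
  refine Set.infinite_univ ((hG.finite_support ((divisiblePart G).subtype.comp f)).subset ?_)
  intro n _
  simpa [hf] using hne

theorem finite_ne_zero_of_isFactorialSum (hG : IsSlender G) {y : ℕ → G}
    (hy : ∀ a : ℕ → ℕ, ∃ g, IsFactorialSum (fun n => a n • y n) g) : {n | y n ≠ 0}.Finite := by
  obtain ⟨f, hf⟩ := exists_addMonoidHom_isFactorialSum hG.divisiblePart_eq_bot
    (exists_isFactorialSum_zsmul hy)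
  have hf_single (n : ℕ) : f (Pi.single n 1) = n.factorial • y n := by
    refine (hf _).eq_of_divisiblePart_eq_bot hG.divisiblePart_eq_bot ?_
    convert IsFactorialSum.single n (y n) using 1
    funext m
    rcases eq_or_ne m n with rfl | hmn
    · simp
    · simp [hmn]
  have := hG.torsionFree
  refine (hG.finite_support f).subset fun n hn => ?_
  rw [Set.mem_ofPred_eq, hf_single, Ne, nsmul_eq_zero_iff_right n.factorial_ne_zero]
  exact hn

end IsSlender

namespace groupLanguage

variable {α : Type w}

/-- The constant `0` as a term. -/
def zeroTerm : groupLanguage.Term α :=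
  Term.func GroupFunctions.zero ![]

/-- The sum `s + t` as a term. -/
def addTerm (s t : groupLanguage.Term α) : groupLanguage.Term α :=
  Term.func GroupFunctions.add ![s, t]

/-- The multiple `n • t` as a term; the language has no symbol for it, so it is spelled out as an
iterated sum. -/
def nsmulTerm : ℕ → groupLanguage.Term α → groupLanguage.Term α
  | 0, _ => zeroTerm
  | n + 1, t => addTerm (nsmulTerm n t) t

variable {G : Type u} [AddCommGroup G] (v : α → G)

@[simp]
theorem realize_zeroTerm : (zeroTerm : groupLanguage.Term α).realize v = 0 := rfl

@[simp]
theorem realize_addTerm (s t : groupLanguage.Term α) :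
    (addTerm s t).realize v = s.realize v + t.realize v := rfl

@[simp]
theorem realize_nsmulTerm (n : ℕ) (t : groupLanguage.Term α) :
    (nsmulTerm n t).realize v = n • t.realize v := by
  induction n with
  | zero => simp [nsmulTerm]
  | succ n ih => simp [nsmulTerm, ih, succ_nsmul]

end groupLanguage

namespace InfFormula

open groupLanguage

/-- The formula saying that the series `∑ n! • a n • y n` has a sum, in the sense of
`IsFactorialSum`. The coefficients are natural numbers because the language has no symbol for
negation. -/
def factorialSummable {α : Type w} (y : ℕ → α) (a : ℕ → ℕ) : InfFormula groupLanguage α :=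
  ex (ULift ℕ) (conj (ULift ℕ) fun n => equal (.var (.inr n))
    (addTerm (nsmulTerm (a n.down) (.var (.inl (y n.down))))
      (nsmulTerm (n.down + 1) (.var (.inr ⟨n.down + 1⟩)))))

/-- The sentence saying that there are nonzero elements `y n` such that all series
`∑ n! • a n • y n` have a sum. -/
def existsFactorialSummable : InfSentence.{0, 0, w} groupLanguage :=
  ex (ULift ℕ) (conj (ULift (ℕ ⊕ (ℕ → ℕ))) fun i => i.down.elim
    (fun n => not (equal (.var (.inr ⟨n⟩)) zeroTerm))
    (fun a => factorialSummable (fun n => .inr ⟨n⟩) a))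

theorem realize_factorialSummable {α : Type w} {G : Type u} [AddCommGroup G] (y : ℕ → α)
    (a : ℕ → ℕ) (s : α → G) :
    (factorialSummable y a).Realize G s ↔ ∃ g, IsFactorialSum (fun n => a n • s (y n)) g := by
  constructor
  · rintro ⟨r, hr⟩
    exact ⟨_, fun n => r ⟨n⟩, rfl, fun n => by simpa [Realize] using hr ⟨n⟩⟩
  · rintro ⟨_, r, -, hr⟩
    exact ⟨fun n => r n.down, fun n => by simpa [Realize] using hr n.down⟩

theorem holds_existsFactorialSummable {G : Type u} [AddCommGroup G] :
    existsFactorialSummable.{w}.Holds G ↔ ∃ y : ℕ → G, (∀ n, y n ≠ 0) ∧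
      ∀ a : ℕ → ℕ, ∃ g, IsFactorialSum (fun n => a n • y n) g := by
  constructor
  · rintro ⟨y, hy⟩
    exact ⟨fun n => y ⟨n⟩, fun n => hy ⟨.inl n⟩,
      fun a => by simpa [realize_factorialSummable] using hy ⟨.inr a⟩⟩
  · rintro ⟨y, hne, hsum⟩
    refine ⟨fun n => y n.down, ?_⟩
    rintro ⟨n | a⟩
    · exact hne n
    · simpa [realize_factorialSummable] using hsum a

theorem inLogic_existsFactorialSummable {κ l : Cardinal.{w}} (hκ : 2 ^ ℵ₀ < κ) (hl : ℵ₀ < l) :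
    existsFactorialSummable.InLogic κ l := by
  have hω : #(ULift.{w} ℕ) = ℵ₀ := by simp
  have hℵ₀ : ℵ₀ < κ := (cantor ℵ₀).trans hκ
  refine ⟨hω.trans_lt hl, by simpa using hκ, ?_⟩
  rintro ⟨_ | a⟩
  · trivial
  · exact ⟨hω.trans_lt hl, hω.trans_lt hℵ₀, fun _ => trivial⟩

theorem holds_existsFactorialSummable_pi {ι : Type u₁} [Infinite ι] (H : ι → Type u₂)
    [∀ i, AddCommGroup (H i)] [∀ i, Nontrivial (H i)] :
    existsFactorialSummable.{w}.Holds (∀ i, H i) := by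
  classical
  choose h hh using fun i => exists_ne (0 : H i)
  let e := Infinite.natEmbedding ι
  exact holds_existsFactorialSummable.2 ⟨fun n => Pi.single (e n) (h (e n)),
    fun n => by simpa using hh (e n), fun a => by
      simpa only [Pi.single_smul] using
        exists_isFactorialSum_pi_single e fun n => a n • h (e n)⟩

theorem not_holds_existsFactorialSummable_of_isSlender {G : Type u} [AddCommGroup G]
    (hG : IsSlender G) : ¬ existsFactorialSummable.{w}.Holds G := by
  rw [holds_existsFactorialSummable]
  rintro ⟨y, hne, hsum⟩
  exact Set.infinite_univ ((hG.finite_ne_zero_of_isFactorialSum hsum).subset fun _ _ => hne _)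

end InfFormula

theorem InfEquivInfty.infEquiv {L : FirstOrder.Language.{u, v}} {κ l : Cardinal.{w}}
    {A : Type u₁} {B : Type u₂} [L.Structure A] [L.Structure B] (h : InfEquivInfty L l A B)
    (hκ : ℵ₀ ≤ κ) (hl : l ≤ κ) : InfEquiv L κ l A B :=
  fun φ hφ => h φ ⟨κ, hκ, hl, hφ⟩

theorem corollary0p2_general {ι : Type u₁} [Infinite ι] (H : ι → Type u₂)
    [∀ i, AddCommGroup (H i)] [∀ i, Nontrivial (H i)] (G : Type u) [AddCommGroup G]
    (hG : IsSlender G) :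
    ¬ InfEquivInfty groupLanguage (ℵ₁ : Cardinal.{w}) (∀ i, H i) G ∧
      ¬ InfEquiv groupLanguage (Order.succ ((2 : Cardinal.{w}) ^ (ℵ₀ : Cardinal.{w}))) ℵ₁
        (∀ i, H i) G := by
  have hκ : (2 : Cardinal.{w}) ^ ℵ₀ < Order.succ (2 ^ ℵ₀) := Order.lt_succ _
  have hℵ₁ : ℵ₁ ≤ Order.succ ((2 : Cardinal.{w}) ^ ℵ₀) := by
    rw [← succ_aleph0]
    exact Order.succ_le_succ (cantor ℵ₀).le
  have hnot : ¬ InfEquiv groupLanguage (Order.succ ((2 : Cardinal.{w}) ^ ℵ₀)) ℵ₁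
      (∀ i, H i) G := fun h =>
    InfFormula.not_holds_existsFactorialSummable_of_isSlender hG <|
      (h _ (InfFormula.inLogic_existsFactorialSummable hκ aleph0_lt_aleph_one)).1
        (InfFormula.holds_existsFactorialSummable_pi H)
  exact ⟨fun h => hnot (h.infEquiv (aleph0_lt_aleph_one.le.trans hℵ₁) hℵ₁), hnot⟩

theorem corollary0p2 (G : Type u) [AddCommGroup G] (hG : IsSlender G) :
    ¬ InfEquivInfty groupLanguage (ℵ₁ : Cardinal.{w}) BaerSpecker G ∧
      ¬ InfEquiv groupLanguage (Order.succ ((2 : Cardinal.{w}) ^ (ℵ₀ : Cardinal.{w}))) ℵ₁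
        BaerSpecker G :=
  corollary0p2_general (fun _ : ℕ => ℤ) G hG
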